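/- **Definitions.** An abelian heap is a (possibly empty) set $H$ with a ternary operation satisfying $[[a,b,c],d,e]=[a,b,[c,d,e]]$, $[a,b,b]=a=[b,b,a]$ and $[a,b,c]=[c,b,a]$. A truss is an abelian heap $T$ with an associative multiplication that distributes over $[-,-,-]$ on both sides; it is unital if it has an identity $1$. A left $T$-module is an abelian heap $M$ with an associative action $T\times M\to M$ that preserves $[-,-,-]$ in each variable; if $T$ is unital, $M$ is called unital when $1\cdot m=m$ for all $m\in M$. Right modules are left modules over the opposite truss, and an $S$-$T$-bimodule is a left $S$-module and right $T$-module (on the same abelian heap) with $(s\cdot p)\cdot t=s\cdot(p\cdot t)$. Morphisms of modules are heap morphisms commuting with the action; they form abelian heaps under the pointwise operation. Let $T\text{-}\mathbf{mod}$ be the category of left $T$-modules and $T_1\text{-}\mathbf{mod}$ (for unital $T$) that of unital left $T$-modules. A functor between such categories is a heap functor if it induces heap morphisms between the hom-sets, and cocontinuous if it preserves all small colimits. For a right $T$-module $P$ and a left $T$-module $M$, $P\otimes_T M$ is the abelian heap generated by the symbols $p\otimes m$, subject to $[p,p',p'']\otimes m=[p\otimes m,p'\otimes m,p''\otimes m]$,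 $p\otimes[m,m',m'']=[p\otimes m,p\otimes m',p\otimes m'']$ and $p\cdot t\otimes m=p\otimes t\cdot m$; if $P$ is an $S$-$T$-bimodule it is a left $S$-module by $s\cdot(p\otimes m)=(s\cdot p)\otimes m$. The unital extension $T\sqcup\star$ of $T$ is the coproduct, in the category of abelian heaps, of $T$ and the one-point heap $\{*\}$, with the unique multiplication distributing over $[-,-,-]$ that extends that of $T$ and has $*$ as identity; it is a left $T$-module by multiplication. **Theorem (Eilenberg–Watts for trusses).** Let $T$ and $S$ be trusses. 1. If $F:T\text{-}\mathbf{mod}\to S\text{-}\mathbf{mod}$ is a cocontinuous heap functor, then $F$ is naturally isomorphic to $P\otimes_T-$, where $P=F(T\sqcup\star)$ is the $S$-$T$-bimodule with its given left $S$-action and the right action $p\cdot t=F(\rho_t)(p)$, $\rho_t:z\mapsto z\,t$. 2. If $T$ is unital and $F:T_1\text{-}\mathbf{mod}\to S\text{-}\mathbf{mod}$ is a cocontinuous heap functor, then $F$ is naturally isomorphic to $P'\otimes_T-$, where $P'=F(T)$ is the $S$-$T$-bimodule with right action $p\cdot t=F(\rho_t)(p)$, $\rho_t:x\mapsto xt$,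 and $P'$ is unital as a right $T$-module. 3. A functor $F:T\text{-}\mathbf{mod}\to S\text{-}\mathbf{mod}$ is a left adjoint (that is, has a right adjoint) if and only if it is a cocontinuous heap functor. If $T$ is unital, the same holds for functors $F:T_1\text{-}\mathbf{mod}\to S\text{-}\mathbf{mod}$. -/

import Mathlib

open CategoryTheory

universe u

namespace TrussTheory

/-! ### Abelian heaps -/

/-- An abelian heap; the empty set is allowed.  `br a b c` is the ternary operation `[a, b, c]`. -/
class AbHeap (H : Type u) where
  /-- the ternary operation `[a, b, c]` -/
  br : H → H → H → H
  br_assoc : ∀ a b c d e : H, br (br a b c) d e = br a b (br c d e)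
  br_right : ∀ a b : H, br a b b = a
  br_left : ∀ a b : H, br b b a = a
  br_comm : ∀ a b c : H, br a b c = br c b a

open AbHeap (br)

namespace AbHeap

/-- The retract of an abelian heap at `e`: the abelian group with `a + b = [a, e, b]`. -/
abbrev retract {H : Type u} [AbHeap H] (e : H) : AddCommGroup H where
  add a b := br a e b
  zero := e
  neg a := br e a e
  nsmul := @nsmulRec H ⟨e⟩ ⟨fun a b => br a e b⟩
  zsmul := @zsmulRec H ⟨e⟩ ⟨fun a b => br a e b⟩ ⟨fun a => br e a e⟩
    (@nsmulRec H ⟨e⟩ ⟨fun a b => br a e b⟩)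
  add_assoc a b c := br_assoc a e b e c
  zero_add a := br_left a e
  add_zero a := br_right a e
  add_comm a b := br_comm a e b
  neg_add_cancel a := by
    change br (br e a e) e a = e
    rw [br_assoc, br_left, br_right]

theorem br_eq_retract {H : Type u} [AbHeap H] (e a b c : H) :
    br a b c = let _ := retract e; a + -b + c := by
  change br a b c = br (br a e (br e b e)) e c
  rw [← br_assoc a e e, br_right, br_assoc, br_left]

/-- The transposition rule. -/
theorem br_transpose {H : Type u} [AbHeap H] (a₁ a₂ a₃ b₁ b₂ b₃ c₁ c₂ c₃ : H) :
    br (br a₁ a₂ a₃) (br b₁ b₂ b₃) (br c₁ c₂ c₃) =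
      br (br a₁ b₁ c₁) (br a₂ b₂ c₂) (br a₃ b₃ c₃) := by
  simp only [br_eq_retract a₁]
  let _ := retract a₁
  abel

end AbHeap

/-- The one-element heap. -/
instance : AbHeap PUnit.{u + 1} where
  br _ _ _ := PUnit.unit
  br_assoc _ _ _ _ _ := rfl
  br_right _ _ := rfl
  br_left _ _ := rfl
  br_comm _ _ _ := rfl

instance (H : Type u) [AbHeap H] : AbHeap Hᵐᵒᵖ where
  br a b c := MulOpposite.op (br a.unop b.unop c.unop)
  br_assoc _ _ _ _ _ := congrArg MulOpposite.op (AbHeap.br_assoc _ _ _ _ _)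
  br_right _ _ := congrArg MulOpposite.op (AbHeap.br_right _ _)
  br_left _ _ := congrArg MulOpposite.op (AbHeap.br_left _ _)
  br_comm _ _ _ := congrArg MulOpposite.op (AbHeap.br_comm _ _ _)

/-- Morphisms of abelian heaps. -/
@[ext]
structure HeapHom (H K : Type u) [AbHeap H] [AbHeap K] where
  /-- the underlying function -/
  toFun : H → K
  map_br : ∀ a b c : H, toFun (br a b c) = br (toFun a) (toFun b) (toFun c)

instance {H K : Type u} [AbHeap H] [AbHeap K] : CoeFun (HeapHom H K) (fun _ => H → K) :=
  ⟨HeapHom.toFun⟩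

/-- The pointwise heap structure on the set of heap morphisms. -/
instance {H K : Type u} [AbHeap H] [AbHeap K] : AbHeap (HeapHom H K) where
  br f g h := ⟨fun x => br (f x) (g x) (h x), fun a b c => by
    rw [f.map_br, g.map_br, h.map_br, AbHeap.br_transpose]⟩
  br_assoc _ _ _ _ _ := HeapHom.ext (funext fun _ => AbHeap.br_assoc _ _ _ _ _)
  br_right _ _ := HeapHom.ext (funext fun _ => AbHeap.br_right _ _)
  br_left _ _ := HeapHom.ext (funext fun _ => AbHeap.br_left _ _)
  br_comm _ _ _ := HeapHom.ext (funext fun _ => AbHeap.br_comm _ _ _)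

/-! ### Abelian heaps given by generators and relations -/

/-- Formal ternary expressions in the generators `X`. -/
inductive HeapTerm (X : Type u) : Type u
  | of (x : X) : HeapTerm X
  | br (a b c : HeapTerm X) : HeapTerm X

/-- The congruence generated by `r` and the axioms of abelian heaps. -/
inductive HeapCongr {X : Type u} (r : HeapTerm X → HeapTerm X → Prop) :
    HeapTerm X → HeapTerm X → Prop
  | rel {a b} : r a b → HeapCongr r a b
  | refl (a) : HeapCongr r a a
  | symm {a b} : HeapCongr r a b → HeapCongr r b a
  | trans {a b c} : HeapCongr r a b → HeapCongr r b c → HeapCongr r a c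
  | congr {a b c a' b' c'} : HeapCongr r a a' → HeapCongr r b b' → HeapCongr r c c' →
      HeapCongr r (.br a b c) (.br a' b' c')
  | br_assoc (a b c d e) : HeapCongr r (.br (.br a b c) d e) (.br a b (.br c d e))
  | br_right (a b) : HeapCongr r (.br a b b) a
  | br_left (a b) : HeapCongr r (.br b b a) a
  | br_comm (a b c) : HeapCongr r (.br a b c) (.br c b a)

/-- The setoid of `HeapCongr`. -/
def heapSetoid {X : Type u} (r : HeapTerm X → HeapTerm X → Prop) : Setoid (HeapTerm X) :=
  ⟨HeapCongr r, .refl, .symm, .trans⟩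

/-- The abelian heap with generators `X` and relations `r`. -/
def PresHeap {X : Type u} (r : HeapTerm X → HeapTerm X → Prop) : Type u :=
  Quotient (heapSetoid r)

namespace PresHeap

variable {X : Type u} {r : HeapTerm X → HeapTerm X → Prop}

/-- The operation `[a, b, c]` on classes. -/
def opBr (a b c : PresHeap r) : PresHeap r :=
  _root_.Quotient.liftOn a
    (fun a => _root_.Quotient.liftOn₂ b c
      (fun b c => (_root_.Quotient.mk (heapSetoid r) (.br a b c) : PresHeap r))
      fun _ _ _ _ hb hc => _root_.Quotient.sound (HeapCongr.congr (.refl _) hb hc))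
    fun a a' ha => by
      induction b, c using _root_.Quotient.inductionOn₂ with
      | h b c => exact _root_.Quotient.sound (HeapCongr.congr ha (.refl _) (.refl _))

instance : AbHeap (PresHeap r) where
  br := opBr
  br_assoc := by
    rintro ⟨a⟩ ⟨b⟩ ⟨c⟩ ⟨d⟩ ⟨e⟩; exact _root_.Quotient.sound (HeapCongr.br_assoc a b c d e)
  br_right := by rintro ⟨a⟩ ⟨b⟩; exact _root_.Quotient.sound (HeapCongr.br_right a b)
  br_left := by rintro ⟨a⟩ ⟨b⟩; exact _root_.Quotient.sound (HeapCongr.br_left a b)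
  br_comm := by rintro ⟨a⟩ ⟨b⟩ ⟨c⟩; exact _root_.Quotient.sound (HeapCongr.br_comm a b c)

/-- The image of a generator. -/
def of (r : HeapTerm X → HeapTerm X → Prop) (x : X) : PresHeap r :=
  _root_.Quotient.mk (heapSetoid r) (.of x)

/-- Evaluation of a formal expression in an abelian heap. -/
def eval {H : Type u} [AbHeap H] (f : X → H) : HeapTerm X → H
  | .of x => f x
  | .br a b c => AbHeap.br (eval f a) (eval f b) (eval f c)

theorem eval_congr {H : Type u} [AbHeap H] (f : X → H)
    (hf : ∀ a b, r a b → eval f a = eval f b) {a b : HeapTerm X} (h : HeapCongr r a b) :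
    eval f a = eval f b := by
  induction h with
  | rel h => exact hf _ _ h
  | refl => rfl
  | symm _ ih => exact ih.symm
  | trans _ _ ih₁ ih₂ => exact ih₁.trans ih₂
  | congr _ _ _ ih₁ ih₂ ih₃ => simp only [eval, ih₁, ih₂, ih₃]
  | br_assoc => exact AbHeap.br_assoc _ _ _ _ _
  | br_right => exact AbHeap.br_right _ _
  | br_left => exact AbHeap.br_left _ _
  | br_comm => exact AbHeap.br_comm _ _ _

/-- The universal property: a function on generators that respects the relations extends to a
heap morphism. -/
def lift {H : Type u} [AbHeap H] (f : X → H) (hf : ∀ a b, r a b → eval f a = eval f b) :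
    HeapHom (PresHeap r) H where
  toFun := _root_.Quotient.lift (eval f) fun _ _ h => eval_congr f hf h
  map_br := by rintro ⟨a⟩ ⟨b⟩ ⟨c⟩; rfl

@[simp]
theorem lift_of {H : Type u} [AbHeap H] (f : X → H)
    (hf : ∀ a b, r a b → eval f a = eval f b) (x : X) : lift f hf (of r x) = f x := rfl

theorem of_rel {a b : HeapTerm X} (h : r a b) : eval (of r) a = eval (of r) b := by
  have key : ∀ t : HeapTerm X, eval (of r) t = _root_.Quotient.mk (heapSetoid r) t := by
    intro t
    induction t with
    | of x => rfl
    | br a b c iha ihb ihc => simp only [eval, iha, ihb, ihc]; rfl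
  rw [key, key]
  exact _root_.Quotient.sound (HeapCongr.rel h)

@[elab_as_elim]
theorem induction {p : PresHeap r → Prop} (h₁ : ∀ x, p (of r x))
    (h₂ : ∀ a b c, p a → p b → p c → p (br a b c)) (z : PresHeap r) : p z := by
  induction z using _root_.Quotient.inductionOn with
  | h t =>
    induction t with
    | of x => exact h₁ x
    | br a b c iha ihb ihc => exact h₂ _ _ _ iha ihb ihc

end PresHeap

/-! ### Direct sum of abelian heaps -/

/-- The relations of the direct sum: the heap operations of `M` and of `N`. -/
inductive SumRel (M N : Type u) [AbHeap M] [AbHeap N] :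
    HeapTerm (M ⊕ N) → HeapTerm (M ⊕ N) → Prop
  | inl (a b c : M) : SumRel M N (.of (.inl (br a b c)))
      (.br (.of (.inl a)) (.of (.inl b)) (.of (.inl c)))
  | inr (a b c : N) : SumRel M N (.of (.inr (br a b c)))
      (.br (.of (.inr a)) (.of (.inr b)) (.of (.inr c)))

/-- The direct sum (coproduct) `M ⊞ N` of abelian heaps: the abelian heap generated by the
disjoint union subject to the heap operations of `M` and `N`. -/
abbrev HeapSum (M N : Type u) [AbHeap M] [AbHeap N] : Type u := PresHeap (SumRel M N)

namespace HeapSum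

variable {M N K : Type u} [AbHeap M] [AbHeap N] [AbHeap K]

/-- The first structure map. -/
def inl : HeapHom M (HeapSum M N) :=
  ⟨fun m => PresHeap.of _ (.inl m), fun a b c => PresHeap.of_rel (SumRel.inl a b c)⟩

/-- The second structure map. -/
def inr : HeapHom N (HeapSum M N) :=
  ⟨fun n => PresHeap.of _ (.inr n), fun a b c => PresHeap.of_rel (SumRel.inr a b c)⟩

/-- The morphism out of the direct sum given by a pair of morphisms. -/
def desc (f : HeapHom M K) (g : HeapHom N K) : HeapHom (HeapSum M N) K :=
  PresHeap.lift (Sum.elim f g) (by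
    intro a b h
    cases h with
    | inl a b c => exact f.map_br a b c
    | inr a b c => exact g.map_br a b c)

@[simp]
theorem desc_inl (f : HeapHom M K) (g : HeapHom N K) (m : M) : desc f g (inl m) = f m := rfl

@[simp]
theorem desc_inr (f : HeapHom M K) (g : HeapHom N K) (n : N) : desc f g (inr n) = g n := rfl

@[elab_as_elim]
theorem induction {p : HeapSum M N → Prop} (h₁ : ∀ m : M, p (inl m)) (h₂ : ∀ n : N, p (inr n))
    (h₃ : ∀ a b c, p a → p b → p c → p (br a b c)) (z : HeapSum M N) : p z :=
  PresHeap.induction (fun x => match x with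
    | .inl m => h₁ m
    | .inr n => h₂ n) h₃ z

end HeapSum

/-! ### Trusses and their modules -/

/-- A truss: an abelian heap with an associative multiplication distributing over the heap
operation. -/
class Truss (T : Type u) extends AbHeap T, Semigroup T where
  mul_br : ∀ s a b c : T, s * br a b c = br (s * a) (s * b) (s * c)
  br_mul : ∀ a b c s : T, br a b c * s = br (a * s) (b * s) (c * s)

/-- A truss with identity. -/
class UnitalTruss (T : Type u) [Truss T] extends One T where
  one_mul : ∀ t : T, 1 * t = t
  mul_one : ∀ t : T, t * 1 = t

/-- The opposite truss. -/
instance (T : Type u) [Truss T] : Truss Tᵐᵒᵖ where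
  mul_br _ _ _ _ := congrArg MulOpposite.op (Truss.br_mul _ _ _ _)
  br_mul _ _ _ _ := congrArg MulOpposite.op (Truss.mul_br _ _ _ _)

/-- A left module over a truss.  A right `T`-module is a left module over the opposite truss
`Tᵐᵒᵖ`, with `m · t = MulOpposite.op t • m`. -/
class TrussModule (T M : Type u) [Truss T] [AbHeap M] extends SMul T M where
  mul_smul : ∀ (s t : T) (m : M), (s * t) • m = s • t • m
  br_smul : ∀ (a b c : T) (m : M), br a b c • m = br (a • m) (b • m) (c • m)
  smul_br : ∀ (t : T) (a b c : M), t • br a b c = br (t • a) (t • b) (t • c)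

/-- `T`-linear maps: heap morphisms that respect the action. -/
structure LinMap (T M N : Type u) [Truss T] [AbHeap M] [AbHeap N] [TrussModule T M]
    [TrussModule T N] extends HeapHom M N where
  map_smul : ∀ (t : T) (m : M), toFun (t • m) = t • toFun m

namespace LinMap

variable {T M N K : Type u} [Truss T] [AbHeap M] [AbHeap N] [AbHeap K] [TrussModule T M]
  [TrussModule T N] [TrussModule T K]

instance : CoeFun (LinMap T M N) (fun _ => M → N) := ⟨fun f => f.toFun⟩

@[ext]
theorem ext {f g : LinMap T M N} (h : ∀ m, f m = g m) : f = g := by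
  cases f; cases g
  congr
  exact HeapHom.ext (funext h)

/-- The identity map. -/
def id (T M : Type u) [Truss T] [AbHeap M] [TrussModule T M] : LinMap T M M where
  toFun m := m
  map_br _ _ _ := rfl
  map_smul _ _ := rfl

/-- Composition: first `f`, then `g`. -/
def comp (f : LinMap T M N) (g : LinMap T N K) : LinMap T M K where
  toFun m := g (f m)
  map_br a b c := by rw [f.map_br, g.map_br]
  map_smul t m := by rw [f.map_smul, g.map_smul]

/-- The pointwise heap structure on the set of `T`-linear maps. -/
instance : AbHeap (LinMap T M N) where
  br f g h :=
    { toHeapHom := br f.toHeapHom g.toHeapHom h.toHeapHom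
      map_smul := fun t m => by
        change br (f (t • m)) (g (t • m)) (h (t • m)) = t • br (f m) (g m) (h m)
        rw [f.map_smul, g.map_smul, h.map_smul, TrussModule.smul_br] }
  br_assoc _ _ _ _ _ := ext fun _ => AbHeap.br_assoc _ _ _ _ _
  br_right _ _ := ext fun _ => AbHeap.br_right _ _
  br_left _ _ := ext fun _ => AbHeap.br_left _ _
  br_comm _ _ _ := ext fun _ => AbHeap.br_comm _ _ _

@[simp]
theorem br_apply (f g h : LinMap T M N) (m : M) : (br f g h) m = br (f m) (g m) (h m) := rfl

end LinMap

/-! ### The categories of modules and of unital modules, and heap functors -/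

/-- Objects of the category of left `T`-modules (the empty module included). -/
structure LMod (T : Type u) [Truss T] : Type (u + 1) where
  /-- the underlying set -/
  carrier : Type u
  [heap : AbHeap carrier]
  [module : TrussModule T carrier]

attribute [instance] LMod.heap LMod.module

instance (T : Type u) [Truss T] : Category.{u} (LMod T) where
  Hom M N := LinMap T M.carrier N.carrier
  id M := LinMap.id T M.carrier
  comp f g := LinMap.comp f g

instance {T : Type u} [Truss T] (M N : LMod T) : AbHeap (M ⟶ N) :=
  inferInstanceAs (AbHeap (LinMap T M.carrier N.carrier))

/-- The underlying linear map of a morphism of modules. -/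
abbrev LMod.lin {T : Type u} [Truss T] {M N : LMod T} (f : M ⟶ N) :
    LinMap T M.carrier N.carrier := f

/-- Objects of the category of unital left modules over a unital truss. -/
structure UMod (T : Type u) [Truss T] [UnitalTruss T] : Type (u + 1) extends LMod T where
  one_smul : ∀ m : carrier, (1 : T) • m = m

instance (T : Type u) [Truss T] [UnitalTruss T] : Category.{u} (UMod T) where
  Hom M N := LinMap T M.carrier N.carrier
  id M := LinMap.id T M.carrier
  comp f g := LinMap.comp f g

instance {T : Type u} [Truss T] [UnitalTruss T] (M N : UMod T) : AbHeap (M ⟶ N) :=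
  inferInstanceAs (AbHeap (LinMap T M.carrier N.carrier))

/-- The inclusion of unital modules into all modules. -/
def UMod.incl (T : Type u) [Truss T] [UnitalTruss T] : UMod T ⥤ LMod T where
  obj M := M.toLMod
  map f := f

/-- A heap functor: it induces heap morphisms between the hom-sets. -/
def IsHeapFunctor {C D : Type (u + 1)} [Category.{u} C] [Category.{u} D]
    [∀ X Y : C, AbHeap (X ⟶ Y)] [∀ X Y : D, AbHeap (X ⟶ Y)] (F : C ⥤ D) : Prop :=
  ∀ (X Y : C) (f g h : X ⟶ Y), F.map (br f g h) = br (F.map f) (F.map g) (F.map h)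

/-- A cocontinuous functor: it preserves all small colimits. -/
abbrev IsCocontinuous {C D : Type (u + 1)} [Category.{u} C] [Category.{u} D] (F : C ⥤ D) :
    Prop :=
  Limits.PreservesColimitsOfSize.{u, u} F

/-! ### The unital extension -/

/-- The unital extension `T ⊞ ⋆` of a truss. -/
def UnitExt (T : Type u) [Truss T] : Type u := HeapSum T PUnit.{u + 1}

namespace UnitExt

variable (T : Type u) [Truss T]

instance : AbHeap (UnitExt T) := inferInstanceAs (AbHeap (HeapSum T PUnit.{u + 1}))

/-- The canonical map `T → T ⊞ ⋆`. -/
def ι : HeapHom T (UnitExt T) := HeapSum.inl (M := T) (N := PUnit.{u + 1})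

/-- The adjoined identity `*`. -/
def star : UnitExt T := HeapSum.inr (M := T) (N := PUnit.{u + 1}) PUnit.unit

variable {T}

@[elab_as_elim]
theorem induction {p : UnitExt T → Prop} (h₁ : ∀ t : T, p (ι T t)) (h₂ : p (star T))
    (h₃ : ∀ a b c, p a → p b → p c → p (br a b c)) (z : UnitExt T) : p z :=
  HeapSum.induction (M := T) (N := PUnit.{u + 1}) h₁ (fun _ => h₂) h₃ z

/-- The heap morphism from the unital extension with given restriction to `T` and value at `*`. -/
def desc {K : Type u} [AbHeap K] (f : HeapHom T K) (k : K) : HeapHom (UnitExt T) K :=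
  HeapSum.desc f ⟨fun _ => k, fun _ _ _ => (AbHeap.br_right k k).symm⟩

@[simp]
theorem desc_ι {K : Type u} [AbHeap K] (f : HeapHom T K) (k : K) (t : T) :
    desc f k (ι T t) = f t := rfl

@[simp]
theorem desc_star {K : Type u} [AbHeap K] (f : HeapHom T K) (k : K) :
    desc f k (star T) = k := rfl

/-- Left multiplication by an element of `T`: `t' ↦ t t'`, `* ↦ t`. -/
def mulLeft (t : T) : HeapHom (UnitExt T) (UnitExt T) :=
  desc ⟨fun t' => ι T (t * t'), fun a b c => by rw [Truss.mul_br, (ι T).map_br]⟩ (ι T t)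

theorem mulLeft_br (a b c : T) :
    mulLeft (br a b c) = br (mulLeft a) (mulLeft b) (mulLeft c) := by
  ext z
  change _ = br (mulLeft a z) (mulLeft b z) (mulLeft c z)
  induction z using induction with
  | h₁ t => simp only [mulLeft, desc_ι, Truss.br_mul, (ι T).map_br]
  | h₂ => simp only [mulLeft, desc_star, (ι T).map_br]
  | h₃ x y z hx hy hz => simp only [HeapHom.map_br, hx, hy, hz, AbHeap.br_transpose]

/-- The multiplication as a heap morphism into heap endomorphisms, with `*` acting as the
identity. -/
def mulHom : HeapHom (UnitExt T) (HeapHom (UnitExt T) (UnitExt T)) :=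
  desc ⟨mulLeft, mulLeft_br⟩ ⟨fun z => z, fun _ _ _ => rfl⟩

instance : Mul (UnitExt T) := ⟨fun x y => mulHom x y⟩

@[simp] theorem ι_mul_ι (s t : T) : ι T s * ι T t = ι T (s * t) := rfl

@[simp] theorem ι_mul_star (t : T) : ι T t * star T = ι T t := rfl

@[simp] theorem star_mul' (z : UnitExt T) : star T * z = z := rfl

theorem mul_br' (s a b c : UnitExt T) : s * br a b c = br (s * a) (s * b) (s * c) :=
  (mulHom s).map_br a b c

theorem br_mul' (a b c s : UnitExt T) : br a b c * s = br (a * s) (b * s) (c * s) :=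
  congrArg (fun f : HeapHom (UnitExt T) (UnitExt T) => f s) (mulHom.map_br a b c)

theorem mul_star' (z : UnitExt T) : z * star T = z := by
  induction z using induction with
  | h₁ t => rfl
  | h₂ => rfl
  | h₃ x y z hx hy hz => rw [br_mul', hx, hy, hz]

theorem mul_assoc' (x y z : UnitExt T) : x * y * z = x * (y * z) := by
  induction x using induction with
  | h₂ => rfl
  | h₃ a b c ha hb hc => simp only [br_mul', ha, hb, hc]
  | h₁ t =>
    induction y using induction with
    | h₂ => rfl
    | h₃ a b c ha hb hc => simp only [br_mul', mul_br', ha, hb, hc]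
    | h₁ t' =>
      induction z using induction with
      | h₂ => rfl
      | h₃ a b c ha hb hc => simp only [mul_br', ha, hb, hc]
      | h₁ t'' => simp only [ι_mul_ι, mul_assoc]

instance : Truss (UnitExt T) where
  mul_assoc := mul_assoc'
  mul_br := mul_br'
  br_mul := br_mul'

instance : UnitalTruss (UnitExt T) where
  one := star T
  one_mul := star_mul'
  mul_one := mul_star'

/-- The left `T`-module structure obtained by restriction of scalars along `ι`. -/
instance : TrussModule T (UnitExt T) where
  smul t z := ι T t * z
  mul_smul s t z := mul_assoc' (ι T s) (ι T t) z
  br_smul a b c z := by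
    change ι T (br a b c) * z = _
    rw [(ι T).map_br, br_mul']; rfl
  smul_br t a b c := mul_br' (ι T t) a b c

end UnitExt

/-! ### Bimodules and tensor products -/

/-- An `S`-`T`-bimodule. -/
structure Bimod (S T : Type u) [Truss S] [Truss T] : Type (u + 1) where
  /-- the underlying set -/
  carrier : Type u
  [heap : AbHeap carrier]
  [left : TrussModule S carrier]
  [right : TrussModule Tᵐᵒᵖ carrier]
  smul_comm : ∀ (s : S) (t : T) (p : carrier),
    MulOpposite.op t • s • p = s • MulOpposite.op t • p

attribute [instance] Bimod.heap Bimod.left Bimod.right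

/-- The relations between simple tensors: linearity in each variable and `T`-balancedness. -/
inductive TensorRel (T P M : Type u) [Truss T] [AbHeap P] [AbHeap M] [TrussModule Tᵐᵒᵖ P]
    [TrussModule T M] : HeapTerm (P × M) → HeapTerm (P × M) → Prop
  | br_left (p p' p'' : P) (m : M) : TensorRel T P M (.of (br p p' p'', m))
      (.br (.of (p, m)) (.of (p', m)) (.of (p'', m)))
  | br_right (p : P) (m m' m'' : M) : TensorRel T P M (.of (p, br m m' m''))
      (.br (.of (p, m)) (.of (p, m')) (.of (p, m'')))
  | balanced (p : P) (t : T) (m : M) : TensorRel T P M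
      (.of (MulOpposite.op t • p, m)) (.of (p, t • m))

/-- The tensor product `P ⊗_T M` of a right `T`-module `P` and a left `T`-module `M`: the abelian
heap generated by simple tensors subject to the relations `TensorRel`. -/
abbrev Tensor (T P M : Type u) [Truss T] [AbHeap P] [AbHeap M] [TrussModule Tᵐᵒᵖ P]
    [TrussModule T M] : Type u :=
  PresHeap (TensorRel T P M)

namespace Tensor

/-- `T`-balanced bilinear maps. -/
structure IsBalanced (T : Type u) {P M H : Type u} [Truss T] [AbHeap P] [AbHeap M]
    [TrussModule Tᵐᵒᵖ P] [TrussModule T M] [AbHeap H] (f : P → M → H) : Prop where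
  br_left : ∀ p p' p'' m, f (br p p' p'') m = br (f p m) (f p' m) (f p'' m)
  br_right : ∀ p m m' m'', f p (br m m' m'') = br (f p m) (f p m') (f p m'')
  balanced : ∀ (p : P) (t : T) (m : M), f (MulOpposite.op t • p) m = f p (t • m)

variable {S T P M N H : Type u} [Truss S] [Truss T] [AbHeap P] [AbHeap M] [AbHeap N]
  [AbHeap H] [TrussModule Tᵐᵒᵖ P] [TrussModule T M] [TrussModule T N]

/-- The simple tensor `p ⊗ m`. -/
def tmul (T : Type u) {P M : Type u} [Truss T] [AbHeap P] [AbHeap M] [TrussModule Tᵐᵒᵖ P]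
    [TrussModule T M] (p : P) (m : M) : Tensor T P M :=
  PresHeap.of _ (p, m)

theorem tmul_balanced : IsBalanced T (fun (p : P) (m : M) => tmul T p m) where
  br_left p p' p'' m := PresHeap.of_rel (TensorRel.br_left p p' p'' m)
  br_right p m m' m'' := PresHeap.of_rel (TensorRel.br_right p m m' m'')
  balanced p t m := PresHeap.of_rel (TensorRel.balanced p t m)

/-- The universal property of the tensor product. -/
def lift (f : P → M → H) (hf : IsBalanced T f) : HeapHom (Tensor T P M) H :=
  PresHeap.lift (fun x => f x.1 x.2) (by
    intro a b h
    cases h with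
    | br_left p p' p'' m => exact hf.br_left p p' p'' m
    | br_right p m m' m'' => exact hf.br_right p m m' m''
    | balanced p t m => exact hf.balanced p t m)

@[simp]
theorem lift_tmul (f : P → M → H) (hf : IsBalanced T f) (p : P) (m : M) :
    lift f hf (tmul T p m) = f p m := rfl

@[elab_as_elim]
theorem induction {q : Tensor T P M → Prop} (h₁ : ∀ p m, q (tmul T p m))
    (h₂ : ∀ a b c, q a → q b → q c → q (br a b c)) (z : Tensor T P M) : q z :=
  PresHeap.induction (fun x => h₁ x.1 x.2) h₂ z

theorem lift_unique (f : P → M → H) (hf : IsBalanced T f) (g : HeapHom (Tensor T P M) H)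
    (hg : ∀ p m, g (tmul T p m) = f p m) : g = lift f hf := by
  ext z
  induction z using induction with
  | h₁ p m => rw [hg, lift_tmul]
  | h₂ a b c ha hb hc => rw [g.map_br, (lift f hf).map_br, ha, hb, hc]

end Tensor

namespace Bimod

variable {S T : Type u} [Truss S] [Truss T] (P : Bimod S T)

open Tensor in
/-- The endomorphism `p ⊗ m ↦ (s · p) ⊗ m`. -/
def tensorSMul (M : LMod T) (s : S) :
    HeapHom (Tensor T P.carrier M.carrier) (Tensor T P.carrier M.carrier) :=
  lift (fun p m => tmul T (s • p) m)
    { br_left := fun p p' p'' m => by rw [TrussModule.smul_br, tmul_balanced.br_left]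
      br_right := fun p m m' m'' => tmul_balanced.br_right _ _ _ _
      balanced := fun p t m => by rw [← P.smul_comm]; exact tmul_balanced.balanced _ _ _ }

open Tensor in
/-- The left `S`-module structure on `P ⊗_T M`, with `s · (p ⊗ m) = (s · p) ⊗ m`. -/
instance (M : LMod T) : TrussModule S (Tensor T P.carrier M.carrier) where
  smul s z := P.tensorSMul M s z
  mul_smul s s' z := by
    change P.tensorSMul M (s * s') z = P.tensorSMul M s (P.tensorSMul M s' z)
    induction z using Tensor.induction with
    | h₁ p m => simp only [tensorSMul, lift_tmul, TrussModule.mul_smul]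
    | h₂ a b c ha hb hc => simp only [HeapHom.map_br, ha, hb, hc]
  br_smul a b c z := by
    change P.tensorSMul M (br a b c) z =
      br (P.tensorSMul M a z) (P.tensorSMul M b z) (P.tensorSMul M c z)
    induction z using Tensor.induction with
    | h₁ p m =>
      simp only [tensorSMul, lift_tmul, TrussModule.br_smul]
      exact tmul_balanced.br_left _ _ _ _
    | h₂ x y z hx hy hz => simp only [HeapHom.map_br, hx, hy, hz, AbHeap.br_transpose]
  smul_br s a b c := (P.tensorSMul M s).map_br a b c

open Tensor in
/-- The map `P ⊗ f : p ⊗ m ↦ p ⊗ f m`. -/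
def tensorMap {M N : LMod T} (f : M ⟶ N) :
    LinMap S (Tensor T P.carrier M.carrier) (Tensor T P.carrier N.carrier) where
  toHeapHom := lift (fun p m => tmul T p (LMod.lin f m))
    { br_left := fun p p' p'' m => tmul_balanced.br_left _ _ _ _
      br_right := fun p m m' m'' => by
        rw [(LMod.lin f).map_br]; exact tmul_balanced.br_right _ _ _ _
      balanced := fun p t m => by
        rw [(LMod.lin f).map_smul]; exact tmul_balanced.balanced _ _ _ }
  map_smul s z := by
    change lift _ _ (P.tensorSMul M s z) = P.tensorSMul N s (lift _ _ z)
    induction z using Tensor.induction with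
    | h₁ p m => rfl
    | h₂ a b c ha hb hc => simp only [HeapHom.map_br, ha, hb, hc]

/-- The functor `P ⊗_T - : T-mod ⥤ S-mod`. -/
def tensorFunctor : LMod T ⥤ LMod S where
  obj M := { carrier := Tensor T P.carrier M.carrier }
  map f := P.tensorMap f
  map_id M := LinMap.ext fun z => by
    induction z using Tensor.induction with
    | h₁ p m => rfl
    | h₂ a b c ha hb hc => rw [HeapHom.map_br, ha, hb, hc]; rfl
  map_comp f g := LinMap.ext fun z => by
    induction z using Tensor.induction with
    | h₁ p m => rfl
    | h₂ a b c ha hb hc => rw [HeapHom.map_br, ha, hb, hc, ← HeapHom.map_br]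

end Bimod

/-! ### The bimodule attached to a heap functor -/

section

variable {S T : Type u} [Truss S] [Truss T]

/-- A heap functor `F` turns a heap map `ρ : T → End X`, compatible with multiplication in the
opposite order of composition, into a bimodule structure on `F X` with `p · t = F (ρ t) p`. -/
def bimodOfAction {C : Type (u + 1)} [Category.{u} C] [∀ X Y : C, AbHeap (X ⟶ Y)]
    (F : C ⥤ LMod S) (hF : IsHeapFunctor F) (X : C) (ρ : T → (X ⟶ X))
    (hbr : ∀ a b c, ρ (br a b c) = br (ρ a) (ρ b) (ρ c))
    (hmul : ∀ a b, ρ (a * b) = ρ a ≫ ρ b) : Bimod S T where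
  carrier := (F.obj X).carrier
  right :=
    { smul := fun t p => LMod.lin (F.map (ρ t.unop)) p
      mul_smul := fun s t p => by
        change LMod.lin (F.map (ρ (t.unop * s.unop))) p = _
        rw [hmul, F.map_comp]; rfl
      br_smul := fun a b c p => by
        change LMod.lin (F.map (ρ (br a.unop b.unop c.unop))) p = _
        rw [hbr, hF]; rfl
      smul_br := fun t => (LMod.lin (F.map (ρ t.unop))).map_br }
  smul_comm s t p := (LMod.lin (F.map (ρ t))).map_smul s p

/-- The unital extension of `T`, as a left `T`-module. -/
def unitExtMod (T : Type u) [Truss T] : LMod T where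
  carrier := UnitExt T

/-- Right multiplication `z ↦ z · t` on the unital extension. -/
def unitExtRho (t : T) : unitExtMod T ⟶ unitExtMod T :=
  ({
    toFun := fun z : UnitExt T => z * UnitExt.ι T t
    map_br := fun a b c => Truss.br_mul a b c _
    map_smul := fun s z => mul_assoc (UnitExt.ι T s) z (UnitExt.ι T t) } :
    LinMap T (UnitExt T) (UnitExt T))

/-- The `S`-`T`-bimodule `F (T ⊞ ⋆)`, for a heap functor `F : T-mod ⥤ S-mod`. -/
def bimodOf (F : LMod T ⥤ LMod S) (hF : IsHeapFunctor F) : Bimod S T :=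
  bimodOfAction F hF (unitExtMod T) unitExtRho
    (fun a b c => LinMap.ext fun z => by
      change (show UnitExt T from z) * UnitExt.ι T (br a b c) = _
      rw [(UnitExt.ι T).map_br, Truss.mul_br]; rfl)
    (fun a b => LinMap.ext fun z =>
      (mul_assoc (show UnitExt T from z) (UnitExt.ι T a) (UnitExt.ι T b)).symm)

/-- Left multiplication makes a truss a left module over itself. -/
abbrev selfModule (T : Type u) [Truss T] : TrussModule T T where
  smul a b := a * b
  mul_smul := mul_assoc
  br_smul := Truss.br_mul
  smul_br := Truss.mul_br

variable [UnitalTruss T]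

/-- A unital truss `T`, as a unital left module over itself. -/
def regMod (T : Type u) [Truss T] [UnitalTruss T] : UMod T where
  carrier := T
  module := selfModule T
  one_smul := UnitalTruss.one_mul

/-- Right multiplication `x ↦ x t` on `T`. -/
def regRho (t : T) : regMod T ⟶ regMod T :=
  letI := selfModule T
  ({
    toFun := fun x : T => x * t
    map_br := fun a b c => Truss.br_mul a b c t
    map_smul := fun s x => mul_assoc s x t } :
    LinMap T T T)

/-- The `S`-`T`-bimodule `F T`, for a heap functor `F` defined on unital `T`-modules. -/
def bimodOfUnital (F : UMod T ⥤ LMod S) (hF : IsHeapFunctor F) : Bimod S T :=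
  bimodOfAction F hF (regMod T) regRho
    (fun a b c => LinMap.ext fun z => Truss.mul_br (show T from z) a b c)
    (fun a b => LinMap.ext fun z => (mul_assoc (show T from z) a b).symm)

end

end TrussTheory

open TrussTheory

namespace TrussTheory
open TrussTheory.AbHeap (br)

open Limits

/-! ### Functors between heap-enriched categories -/

/-! The engine is the usual one for Eilenberg–Watts: a cocontinuous functor is determined by its
value on a free object of rank one and on the endomorphisms of that object. Let `X` be free on one
generator `gen`. A point `m` of a module `M` is the same as a morphism `lift m : X ⟶ M`, so `p ⊗ m ↦
F (lift m) p` defines a transformation from `F X ⊗ -` to `F` (`FreeGenerator.comparison`). It is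
heap-linear in `m` because `F` is a heap functor, and balanced because `lift (t • m)` is right
multiplication by `t` followed by `lift m`.

At `X` the comparison is invertible, with inverse `p ↦ p ⊗ gen` (`isIso_comparison_app`).
Invertibility spreads to every object (`isIso_of_isIso_app`): every `M` is a coequalizer of maps
between copowers of `X` (`exists_isColimit_cofork`), and both functors preserve copowers and
coequalizers. For the tensor functor this follows from the tensor-hom adjunction.

Both cases of the theorem are handled at once by a fully faithful functor `V` to `T`-modules. For
all modules, `V` is the identity and `X` is the unital extension with generator `*`. For unital
modules, `V` is the inclusion and `X` is `T` with generator `1`.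

For the characterization of left adjoints, one direction transports the tensor-hom adjunction along
the isomorphism. In the other, left adjoints are cocontinuous, and preservation of coproducts alone
already forces the heap condition (`isHeapFunctor_of_isCocontinuous`): the bracket of three parallel
maps factors through a threefold copower. -/

/-- A category whose composition is a heap morphism in each variable. -/
class HeapEnriched (C : Type (u + 1)) [Category.{u} C] [∀ X Y : C, AbHeap (X ⟶ Y)] : Prop where
  br_comp : ∀ {X Y Z : C} (f g h : X ⟶ Y) (k : Y ⟶ Z),
    br f g h ≫ k = br (f ≫ k) (g ≫ k) (h ≫ k)
  comp_br : ∀ {X Y Z : C} (k : X ⟶ Y) (f g h : Y ⟶ Z),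
    k ≫ br f g h = br (k ≫ f) (k ≫ g) (k ≫ h)

section Enriched

variable {C D : Type (u + 1)} [Category.{u} C] [Category.{u} D] [∀ X Y : C, AbHeap (X ⟶ Y)]
  [∀ X Y : D, AbHeap (X ⟶ Y)]

/-- A functor that preserves coproducts is a heap functor. -/
theorem isHeapFunctor_of_isCocontinuous [HeapEnriched C] [HeapEnriched D] [HasCoproducts.{u} C]
    (F : C ⥤ D) (hF : IsCocontinuous F) : IsHeapFunctor F := by
  intro X Y f g h
  -- The three-element index set is lifted to universe `u`, where coproducts are available and
  -- preserved.
  let J := ULift.{u} (Fin 3)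
  let i : J → (X ⟶ ∐ fun _ : J => X) := Sigma.ι fun _ : J => X
  let d (a b c : X ⟶ Y) : (∐ fun _ : J => X) ⟶ Y := Sigma.desc fun j => ![a, b, c] j.down
  have hi (a b c : X ⟶ Y) (j : J) : i j ≫ d a b c = ![a, b, c] j.down := by simp [i, d]
  -- The universal bracket: every `[a, b, c]` is `κ` followed by the copairing of `a`, `b`, `c`.
  let κ : X ⟶ ∐ fun _ : J => X := br (i ⟨0⟩) (i ⟨1⟩) (i ⟨2⟩)
  have hκ (a b c : X ⟶ Y) : κ ≫ d a b c = br a b c := by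
    simp only [κ, HeapEnriched.br_comp, hi]; rfl
  have hc := isColimitCofanMkObjOfIsColimit F (fun _ : J => X) i
    (coproductIsCoproduct fun _ : J => X)
  -- The three copairings on the right are chosen so that, on each summand, two adjacent entries of
  -- the bracket coincide and cancel, leaving `F f`, `F g`, `F h` in turn. This can be tested on
  -- summands because `F` preserves the coproduct.
  have key : F.map (d f g h) = br (F.map (d f g g)) (F.map (d g g g)) (F.map (d g g h)) := by
    refine Cofan.IsColimit.hom_ext hc _ _ fun j => ?_
    change F.map (i j) ≫ _ = F.map (i j) ≫ _
    simp only [HeapEnriched.comp_br, ← F.map_comp, hi]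
    obtain ⟨j⟩ := j
    fin_cases j
    · exact (AbHeap.br_right _ _).symm
    · exact (AbHeap.br_right _ _).symm
    · exact (AbHeap.br_left _ _).symm
  -- Precomposing with `F κ` turns the four copairings into `[f, g, h]`, `[f, g, g] = f`, `[g, g, g]
  -- = g` and `[g, g, h] = h`.
  have := congrArg (F.map κ ≫ ·) key
  simpa only [HeapEnriched.comp_br, ← F.map_comp, hκ, AbHeap.br_right, AbHeap.br_left] using this

end Enriched

instance (T : Type u) [Truss T] : HeapEnriched (LMod T) where
  br_comp _ _ _ k := LinMap.ext fun _ => (LMod.lin k).map_br _ _ _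
  comp_br _ _ _ _ := rfl

instance (T : Type u) [Truss T] [UnitalTruss T] : HeapEnriched (UMod T) where
  br_comp _ _ _ k := LinMap.ext fun _ => (LMod.lin k).map_br _ _ _
  comp_br _ _ _ _ := rfl

/-! ### Coproducts of modules -/

namespace LMod

variable {T : Type u} [Truss T]

/-- The relations of a direct sum of heaps: the heap operations of the summands. -/
inductive CoprodRel {J : Type u} (M : J → LMod T) :
    HeapTerm (Σ j, (M j).carrier) → HeapTerm (Σ j, (M j).carrier) → Prop
  | mk (j : J) (a b c : (M j).carrier) :
      CoprodRel M (.of ⟨j, br a b c⟩) (.br (.of ⟨j, a⟩) (.of ⟨j, b⟩) (.of ⟨j, c⟩))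

variable {J : Type u} (M : J → LMod T)

/-- The structure maps of the direct sum of heaps. -/
def coprodIncl (j : J) : HeapHom (M j).carrier (PresHeap (CoprodRel M)) :=
  ⟨fun m => PresHeap.of _ ⟨j, m⟩, fun a b c => PresHeap.of_rel (CoprodRel.mk j a b c)⟩

/-- The universal property of the direct sum of heaps. -/
def coprodDesc {K : Type u} [AbHeap K] (f : ∀ j, HeapHom (M j).carrier K) :
    HeapHom (PresHeap (CoprodRel M)) K :=
  PresHeap.lift (fun x => f x.1 x.2) (by
    rintro _ _ ⟨j, a, b, c⟩
    exact (f j).map_br a b c)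

variable {M} in
@[elab_as_elim]
theorem coprod_induction {p : PresHeap (CoprodRel M) → Prop} (h₁ : ∀ j m, p (coprodIncl M j m))
    (h₂ : ∀ a b c, p a → p b → p c → p (br a b c)) (z : PresHeap (CoprodRel M)) : p z :=
  PresHeap.induction (fun x => h₁ x.1 x.2) h₂ z

/-- The action of a scalar on the direct sum. -/
def coprodSMul (t : T) : HeapHom (PresHeap (CoprodRel M)) (PresHeap (CoprodRel M)) :=
  coprodDesc M fun j => ⟨fun m => coprodIncl M j (t • m), fun a b c => by
    rw [TrussModule.smul_br, HeapHom.map_br]⟩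

@[simp]
theorem coprodSMul_incl (t : T) (j : J) (m : (M j).carrier) :
    coprodSMul M t (coprodIncl M j m) = coprodIncl M j (t • m) := rfl

instance : TrussModule T (PresHeap (CoprodRel M)) where
  smul t z := coprodSMul M t z
  mul_smul s t z := by
    change coprodSMul M (s * t) z = coprodSMul M s (coprodSMul M t z)
    induction z using coprod_induction with
    | h₁ j m => simp only [coprodSMul_incl, TrussModule.mul_smul]
    | h₂ a b c ha hb hc => simp only [HeapHom.map_br, ha, hb, hc]
  br_smul a b c z := by
    change coprodSMul M (br a b c) z =
      br (coprodSMul M a z) (coprodSMul M b z) (coprodSMul M c z)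
    induction z using coprod_induction with
    | h₁ j m => simp only [coprodSMul_incl, TrussModule.br_smul, HeapHom.map_br]
    | h₂ x y z hx hy hz => simp only [HeapHom.map_br, hx, hy, hz, AbHeap.br_transpose]
  smul_br t a b c := (coprodSMul M t).map_br a b c

theorem smul_coprodIncl (t : T) (j : J) (m : (M j).carrier) :
    t • coprodIncl M j m = coprodIncl M j (t • m) := rfl

variable {M} in
-- Applied to `t = 1`, this makes the direct sum of unital modules unital, so coproducts of unital
-- modules are computed in all modules.
theorem smul_coprod_eq_self (t : T) (h : ∀ j (m : (M j).carrier), t • m = m)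
    (z : PresHeap (CoprodRel M)) : t • z = z := by
  induction z using coprod_induction with
  | h₁ j m => rw [smul_coprodIncl, h]
  | h₂ a b c ha hb hc => rw [TrussModule.smul_br, ha, hb, hc]

/-- The direct sum of modules, as a cofan. -/
def coprodCofan : Cofan M :=
  Cofan.mk { carrier := PresHeap (CoprodRel M) } fun j =>
    ({ toHeapHom := coprodIncl M j, map_smul := fun _ _ => rfl } :
      LinMap T (M j).carrier (PresHeap (CoprodRel M)))

/-- The map out of the direct sum of modules given by a family of maps. -/
def coprodLift {N : LMod T} (f : ∀ j, M j ⟶ N) : (coprodCofan M).pt ⟶ N :=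
  ({ toHeapHom := coprodDesc M fun j => (LMod.lin (f j)).toHeapHom
     map_smul := fun t z => by
      change coprodDesc M _ (coprodSMul M t z) = _
      induction z using coprod_induction with
      | h₁ j m => exact (LMod.lin (f j)).map_smul t m
      | h₂ a b c ha hb hc => simp only [HeapHom.map_br, ha, hb, hc, TrussModule.smul_br] } :
    LinMap T (PresHeap (CoprodRel M)) N.carrier)

/-- The direct sum of modules is their coproduct. -/
def coprodIsColimit : IsColimit (coprodCofan M) :=
  Cofan.IsColimit.mk _ (fun s => coprodLift M s.inj) (fun _ _ => rfl) fun s f hf =>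
    LinMap.ext fun z => by
      induction z using coprod_induction with
      | h₁ j m => exact congrArg (fun g => LMod.lin g m) (hf j)
      | h₂ a b c ha hb hc =>
        exact ((LMod.lin f).map_br a b c).trans (by
          rw [ha, hb, hc]; exact ((LMod.lin (coprodLift M s.inj)).map_br a b c).symm)

instance : HasCoproducts.{u} (LMod T) :=
  hasCoproducts_of_colimit_cofans (fun M => coprodCofan M) fun M => coprodIsColimit M

end LMod

namespace UMod

variable {T : Type u} [Truss T] [UnitalTruss T]

/-- The inclusion of unital modules is fully faithful. -/
def fullyFaithfulIncl : (incl T).FullyFaithful where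
  preimage f := f

/-- The direct sum of unital modules, as a cofan. -/
def coprodCofan {J : Type u} (M : J → UMod T) : Cofan M :=
  Cofan.mk
    { toLMod := (LMod.coprodCofan fun j => (M j).toLMod).pt
      one_smul := LMod.smul_coprod_eq_self _ fun j => (M j).one_smul }
    fun j => (LMod.coprodCofan fun j => (M j).toLMod).inj j

/-- The direct sum of unital modules is their coproduct. -/
def coprodIsColimit {J : Type u} (M : J → UMod T) : IsColimit (coprodCofan M) :=
  Cofan.IsColimit.mk _ (fun s => LMod.coprodLift (fun j => (M j).toLMod) s.inj) (fun _ _ => rfl)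
    fun s f hf => Cofan.IsColimit.hom_ext (LMod.coprodIsColimit fun j => (M j).toLMod)
      (A := s.pt.toLMod) f (LMod.coprodLift (fun j => (M j).toLMod) s.inj) hf

instance : HasCoproducts.{u} (UMod T) :=
  hasCoproducts_of_colimit_cofans (fun M => coprodCofan M) fun M => coprodIsColimit M

end UMod

/-! ### The tensor-hom adjunction -/

namespace Bimod

variable {S T : Type u} [Truss S] [Truss T] (P : Bimod S T)

/-- Right multiplication by `t` on an `S`-`T`-bimodule, as an `S`-linear map. -/
def mulRight (t : T) : LinMap S P.carrier P.carrier where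
  toFun p := MulOpposite.op t • p
  map_br := TrussModule.smul_br _
  map_smul s p := P.smul_comm s t p

/-- The left `T`-module structure on `Hom_S(P, N)`, with `(t · f) p = f (p · t)`. -/
instance (N : LMod S) : TrussModule T (LinMap S P.carrier N.carrier) where
  smul t f := (P.mulRight t).comp f
  -- Evaluated at `p`, this is `p · (s t) = (p · s) · t` under `f`; the order of the factors is
  -- reversed in the opposite truss.
  mul_smul s t f := LinMap.ext fun p =>
    congrArg f.toFun (TrussModule.mul_smul (MulOpposite.op t) (MulOpposite.op s) p)
  br_smul a b c f := LinMap.ext fun p =>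
    (congrArg f.toFun (TrussModule.br_smul (MulOpposite.op a) (MulOpposite.op b)
      (MulOpposite.op c) p)).trans (f.map_br _ _ _)
  smul_br _ _ _ _ := rfl

/-- The functor `Hom_S(P, -) : S-mod ⥤ T-mod`. -/
def homFunctor : LMod S ⥤ LMod T where
  obj N := { carrier := LinMap S P.carrier N.carrier }
  map {N N'} g :=
    ({ toFun := fun f => f.comp (LMod.lin g)
       map_br := fun _ _ _ => LinMap.ext fun _ => (LMod.lin g).map_br _ _ _
       map_smul := fun _ _ => rfl } :
      LinMap T (LinMap S P.carrier N.carrier) (LinMap S P.carrier N'.carrier))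

/-- Currying of linear maps out of the tensor product. -/
def curry {M : LMod T} {N : LMod S} (g : LinMap S (Tensor T P.carrier M.carrier) N.carrier) :
    LinMap T M.carrier (LinMap S P.carrier N.carrier) where
  toFun m :=
    { toFun := fun p => g (Tensor.tmul T p m)
      map_br := fun p p' p'' => by rw [Tensor.tmul_balanced.br_left, g.map_br]
      map_smul := fun s p => g.map_smul s (Tensor.tmul T p m) }
  map_br m m' m'' := LinMap.ext fun p => by
    change g (Tensor.tmul T p (br m m' m'')) = _
    rw [Tensor.tmul_balanced.br_right, g.map_br]; rfl
  map_smul t m := LinMap.ext fun p => (congrArg g.toFun (Tensor.tmul_balanced.balanced p t m)).symm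

/-- The linear map out of the tensor product with the given curried form. -/
def uncurry {M : LMod T} {N : LMod S} (f : LinMap T M.carrier (LinMap S P.carrier N.carrier)) :
    LinMap S (Tensor T P.carrier M.carrier) N.carrier where
  toHeapHom := Tensor.lift (fun p m => f m p)
    { br_left := fun p p' p'' m => (f m).map_br p p' p''
      br_right := fun p m m' m'' => by rw [f.map_br, LinMap.br_apply]
      balanced := fun p t m => by rw [f.map_smul]; rfl }
  map_smul s z := by
    change Tensor.lift _ _ (P.tensorSMul M s z) = _
    induction z using Tensor.induction with
    | h₁ p m => exact (f m).map_smul s p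
    | h₂ a b c ha hb hc => simp only [HeapHom.map_br, ha, hb, hc, TrussModule.smul_br]

theorem tensor_hom_ext {M : LMod T} {N : LMod S}
    {f g : LinMap S (Tensor T P.carrier M.carrier) N.carrier}
    (h : ∀ p m, f (Tensor.tmul T p m) = g (Tensor.tmul T p m)) : f = g :=
  LinMap.ext fun z => by
    induction z using Tensor.induction with
    | h₁ p m => exact h p m
    | h₂ a b c ha hb hc => rw [f.map_br, g.map_br, ha, hb, hc]

/-- The tensor-hom adjunction. -/
def tensorAdjunction : P.tensorFunctor ⊣ P.homFunctor :=
  Adjunction.mkOfHomEquiv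
    { homEquiv := fun _ _ =>
        { toFun := fun g => P.curry (LMod.lin g)
          invFun := fun f => P.uncurry (LMod.lin f)
          left_inv := fun _ => P.tensor_hom_ext fun _ _ => rfl
          right_inv := fun _ => rfl }
      homEquiv_naturality_left_symm := fun _ _ => P.tensor_hom_ext fun _ _ => rfl
      homEquiv_naturality_right := fun _ _ => rfl }

/-- For a bimodule that is unital on the right, `Hom_S(P, -)` takes values in unital modules. -/
def homFunctorUnital [UnitalTruss T] (hP : ∀ p : P.carrier, MulOpposite.op (1 : T) • p = p) :
    LMod S ⥤ UMod T where
  obj N :=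
    { toLMod := P.homFunctor.obj N
      one_smul := fun f => LinMap.ext fun p =>
        congrArg (LinMap.toHeapHom (T := S) (M := P.carrier) f).toFun (hP p) }
  map g := P.homFunctor.map g

/-- The tensor-hom adjunction for unital modules. -/
def tensorAdjunctionUnital [UnitalTruss T]
    (hP : ∀ p : P.carrier, MulOpposite.op (1 : T) • p = p) :
    UMod.incl T ⋙ P.tensorFunctor ⊣ P.homFunctorUnital hP :=
  Adjunction.mkOfHomEquiv
    -- Morphisms of unital modules are all linear maps, so the bijections for arbitrary modules
    -- serve unchanged.
    { homEquiv := fun M N => P.tensorAdjunction.homEquiv M.toLMod N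
      homEquiv_naturality_left_symm := fun f g =>
        P.tensorAdjunction.homEquiv_naturality_left_symm (X' := UMod.toLMod _)
          (X := UMod.toLMod _) f g
      homEquiv_naturality_right := fun f g =>
        P.tensorAdjunction.homEquiv_naturality_right (X := UMod.toLMod _) f g }

end Bimod

/-! ### Free generators -/

section FreeGenerator

variable {S T : Type u} [Truss S] [Truss T] {C : Type (u + 1)} [Category.{u} C]

/-- An object `X` of a category over `T`-modules that is free on one generator. -/
structure FreeGenerator (V : C ⥤ LMod T) (X : C) where
  /-- the generator -/
  gen : (V.obj X).carrier
  /-- the morphism with prescribed value at the generator -/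
  lift : ∀ {M : C}, (V.obj M).carrier → (X ⟶ M)
  lift_gen : ∀ {M : C} (m : (V.obj M).carrier), LMod.lin (V.map (lift m)) gen = m
  hom_ext : ∀ {M : C} (f g : X ⟶ M),
    LMod.lin (V.map f) gen = LMod.lin (V.map g) gen → f = g

namespace FreeGenerator

variable {V : C ⥤ LMod T} {X : C} (E : FreeGenerator V X)

theorem lift_comp {M N : C} (m : (V.obj M).carrier) (f : M ⟶ N) :
    E.lift m ≫ f = E.lift (LMod.lin (V.map f) m) := by
  apply E.hom_ext
  rw [E.lift_gen, V.map_comp]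
  exact congrArg (LMod.lin (V.map f)).toFun (E.lift_gen m)

theorem lift_gen_eq_id : E.lift E.gen = 𝟙 X := by
  apply E.hom_ext
  rw [E.lift_gen, V.map_id]; rfl

/-- Both sides take the generator to `t • m`. This is the source of balancedness of the comparison
map. -/
theorem lift_smul {M : C} (t : T) (m : (V.obj M).carrier) :
    E.lift (t • m) = E.lift (t • E.gen) ≫ E.lift m := by
  rw [E.lift_comp, (LMod.lin _).map_smul, E.lift_gen]

theorem lift_br [∀ X Y : C, AbHeap (X ⟶ Y)] (hV : IsHeapFunctor V) {M : C}
    (a b c : (V.obj M).carrier) :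
    E.lift (br a b c) = br (E.lift a) (E.lift b) (E.lift c) := by
  apply E.hom_ext
  rw [E.lift_gen, hV]
  change _ = br (LMod.lin (V.map (E.lift a)) E.gen) (LMod.lin (V.map (E.lift b)) E.gen)
    (LMod.lin (V.map (E.lift c)) E.gen)
  simp only [E.lift_gen]

/-- The map from the copower of the free object indexed by a set of elements of `M`. -/
noncomputable def copowerDesc [HasCoproducts.{u} C] {M : C} {K : Type u}
    (k : K → (V.obj M).carrier) : (∐ fun _ : K => X) ⟶ M :=
  Sigma.desc fun x => E.lift (k x)

theorem ι_copowerDesc [HasCoproducts.{u} C] {M : C} {K : Type u}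
    (k : K → (V.obj M).carrier) (x : K) :
    Sigma.ι (fun _ : K => X) x ≫ E.copowerDesc k = E.lift (k x) := by
  simp [copowerDesc]

theorem ι_copowerDesc_assoc [HasCoproducts.{u} C] {M N : C} {K : Type u}
    (k : K → (V.obj M).carrier) (x : K) (f : M ⟶ N) :
    Sigma.ι (fun _ : K => X) x ≫ E.copowerDesc k ≫ f = E.lift (k x) ≫ f := by
  rw [← Category.assoc, ι_copowerDesc]

/-- The canonical cover of an object by a free object. -/
noncomputable def cover [HasCoproducts.{u} C] (M : C) :
    (∐ fun _ : (V.obj M).carrier => X) ⟶ M :=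
  E.copowerDesc fun m => m

/-- The summand indexed by `m` carries its generator to `m`. -/
theorem cover_surjective [HasCoproducts.{u} C] (M : C) :
    Function.Surjective (LMod.lin (V.map (E.cover M))).toFun := fun m => by
  have h := E.ι_copowerDesc (M := M) (fun m => m) m
  refine ⟨LMod.lin (V.map (Sigma.ι (fun _ : (V.obj M).carrier => X) m)) E.gen, ?_⟩
  have := congrArg (fun f => LMod.lin (V.map f) E.gen) h
  simp only [E.lift_gen, V.map_comp] at this
  exact this

/-- The kernel pair, as a set, of the underlying function of a morphism. -/
abbrev Ker (V : C ⥤ LMod T) {Q M : C} (q : Q ⟶ M) : Type u :=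
  { x : (V.obj Q).carrier × (V.obj Q).carrier //
    LMod.lin (V.map q) x.1 = LMod.lin (V.map q) x.2 }

/-- A morphism with surjective underlying function is the coequalizer of the two projections of
the free object on its kernel pair. -/
theorem exists_isColimit_cofork [HasCoproducts.{u} C] (hV : V.FullyFaithful) {Q M : C} (q : Q ⟶ M)
    (hq : Function.Surjective (LMod.lin (V.map q)).toFun) :
    ∃ w : (E.copowerDesc fun x : Ker V q => x.1.1) ≫ q =
        (E.copowerDesc fun x : Ker V q => x.1.2) ≫ q,
      Nonempty (IsColimit (Cofork.ofπ q w)) := by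
  have w : (E.copowerDesc fun x : Ker V q => x.1.1) ≫ q =
      (E.copowerDesc fun x : Ker V q => x.1.2) ≫ q :=
    Sigma.hom_ext _ _ fun x => by
      rw [E.ι_copowerDesc_assoc, E.ι_copowerDesc_assoc, E.lift_comp, E.lift_comp, x.2]
  have epi {N : C} (f g : M ⟶ N) (h : q ≫ f = q ≫ g) : f = g := hV.map_injective <|
    LinMap.ext fun m => by
      obtain ⟨z, rfl⟩ := hq m
      have := congrArg (fun f => LMod.lin (V.map f) z) h
      simp only [V.map_comp] at this
      exact this
  refine ⟨w, ⟨Cofork.IsColimit.ofExistsUnique fun s => ?_⟩⟩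
  -- The pair `(a, b)` indexes a summand of the free object on the kernel pair; restricting the
  -- cofork condition to it and evaluating at the generator gives the claim.
  have resp (a b) (h : LMod.lin (V.map q) a = LMod.lin (V.map q) b) :
      LMod.lin (V.map s.π) a = LMod.lin (V.map s.π) b := by
    have := congrArg (Sigma.ι (fun _ : Ker V q => X) ⟨(a, b), h⟩ ≫ ·) s.condition
    simp only [E.ι_copowerDesc_assoc, E.lift_comp] at this
    rw [← E.lift_gen (LMod.lin (V.map s.π) a), this, E.lift_gen]
  -- The section need not be linear: by `resp`, the composite of `s.π` with it does not depend on
  -- the chosen preimages, and this makes the composite linear.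
  let σ := Function.surjInv hq
  have hσ (m) : LMod.lin (V.map q) (σ m) = m := Function.surjInv_eq hq m
  let d : LinMap T (V.obj M).carrier (V.obj s.pt).carrier :=
    { toFun := fun m => LMod.lin (V.map s.π) (σ m)
      map_br := fun a b c => by
        rw [← (LMod.lin (V.map s.π)).map_br]
        apply resp
        rw [(LMod.lin (V.map q)).map_br, hσ, hσ, hσ, hσ]
      map_smul := fun t m => by
        rw [← (LMod.lin (V.map s.π)).map_smul]
        apply resp
        rw [(LMod.lin (V.map q)).map_smul, hσ, hσ] }
  have hd : q ≫ hV.preimage (X := M) (Y := s.pt) d = s.π := hV.map_injective <| by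
    rw [V.map_comp, hV.map_preimage]
    exact LinMap.ext fun z => resp _ _ (hσ _)
  exact ⟨_, hd, fun g hg => epi _ _ (hg.trans hd.symm)⟩

include E in
/-- A natural transformation of cocontinuous functors is invertible as soon as its component at
the free object is. -/
theorem isIso_of_isIso_app [HasCoproducts.{u} C] {D : Type (u + 1)} [Category.{u} D]
    (hV : V.FullyFaithful) {F G : C ⥤ D} (hF : IsCocontinuous F) (hG : IsCocontinuous G)
    (θ : F ⟶ G) (hθ : IsIso (θ.app X)) : IsIso θ := by
  -- The shape of a coequalizer lives in universe `0`, so preservation has to be shrunk from `u`.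
  have hF' : PreservesColimitsOfSize.{0, 0} F := preservesColimitsOfSize_shrink.{0, u, 0, u} F
  have hG' : PreservesColimitsOfSize.{0, 0} G := preservesColimitsOfSize_shrink.{0, u, 0, u} G
  have copower (K : Type u) : IsIso (θ.app (∐ fun _ : K => X)) := by
    have : IsIso (Functor.whiskerLeft (Discrete.functor fun _ : K => X) θ) :=
      (NatTrans.isIso_iff_isIso_app _).2 fun _ => hθ
    exact isIso_app_coconePt_of_preservesColimit _ θ _
      (coproductIsCoproduct fun _ : K => X)
  refine (NatTrans.isIso_iff_isIso_app _).2 fun M => ?_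
  -- Both objects of the parallel pair presenting `M` are copowers of `X`, where `θ` is already
  -- invertible.
  obtain ⟨w, ⟨hc⟩⟩ := E.exists_isColimit_cofork hV (E.cover M) (E.cover_surjective M)
  have : IsIso (Functor.whiskerLeft (parallelPair (E.copowerDesc fun x : Ker V (E.cover M) => x.1.1)
      (E.copowerDesc fun x : Ker V (E.cover M) => x.1.2)) θ) :=
    (NatTrans.isIso_iff_isIso_app _).2 fun j => by
      cases j
      · exact copower _
      · exact copower _
  exact isIso_app_coconePt_of_preservesColimit _ θ _ hc

/-! ### The comparison transformation -/

variable [∀ X Y : C, AbHeap (X ⟶ Y)] (hV : IsHeapFunctor V) (F : C ⥤ LMod S)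
  (hF : IsHeapFunctor F) (ρ : T → (X ⟶ X))
  (hbr : ∀ a b c, ρ (br a b c) = br (ρ a) (ρ b) (ρ c))
  (hmul : ∀ a b, ρ (a * b) = ρ a ≫ ρ b) (hρ : ∀ t, E.lift (t • E.gen) = ρ t)

include hV hρ in
theorem comparison_isBalanced (M : C) :
    Tensor.IsBalanced T (P := (bimodOfAction F hF X ρ hbr hmul).carrier) (M := (V.obj M).carrier)
      (fun p m => LMod.lin (F.map (E.lift m)) p) where
  br_left p p' p'' m := (LMod.lin (F.map (E.lift m))).map_br p p' p''
  br_right p m m' m'' := by rw [E.lift_br hV, hF]; rfl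
  balanced p t m := by
    rw [E.lift_smul, hρ, F.map_comp]; rfl

/-- The natural map `F X ⊗ M ⟶ F M`, `p ⊗ m ↦ F (x ↦ x · m) p`. -/
def comparison : V ⋙ (bimodOfAction F hF X ρ hbr hmul).tensorFunctor ⟶ F where
  app M :=
    ({ toHeapHom := Tensor.lift _ (E.comparison_isBalanced hV F hF ρ hbr hmul hρ M)
       map_smul := fun s z => by
        change Tensor.lift _ _ ((bimodOfAction F hF X ρ hbr hmul).tensorSMul _ s z) = _
        induction z using Tensor.induction with
        | h₁ p m => exact (LMod.lin (F.map (E.lift m))).map_smul s p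
        | h₂ a b c ha hb hc => simp only [HeapHom.map_br, ha, hb, hc, TrussModule.smul_br] } :
      LinMap S (Tensor T (bimodOfAction F hF X ρ hbr hmul).carrier (V.obj M).carrier)
        (F.obj M).carrier)
  naturality M N f := Bimod.tensor_hom_ext (bimodOfAction F hF X ρ hbr hmul) fun p m => by
    change LMod.lin (F.map (E.lift (LMod.lin (V.map f) m))) p =
      LMod.lin (F.map f) (LMod.lin (F.map (E.lift m)) p)
    rw [← E.lift_comp, F.map_comp]; rfl

/-- The hypothesis `hgen` says that `X` is generated as a heap by `gen` and its multiples `t • gen`.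
So every tensor can be moved into the form `p ⊗ gen`. -/
theorem isIso_comparison_app
    (hgen : ∀ q : (V.obj X).carrier → Prop, q E.gen → (∀ t : T, q (t • E.gen)) →
      (∀ a b c, q a → q b → q c → q (br a b c)) → ∀ z, q z) :
    IsIso ((E.comparison hV F hF ρ hbr hmul hρ).app X) := by
  let B := bimodOfAction F hF X ρ hbr hmul
  let inv : LinMap S B.carrier (Tensor T B.carrier (V.obj X).carrier) :=
    { toFun := fun p => Tensor.tmul T p E.gen
      map_br := fun p p' p'' => Tensor.tmul_balanced.br_left p p' p'' E.gen
      map_smul := fun _ _ => rfl }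
  refine ⟨inv, Bimod.tensor_hom_ext B fun p z => ?_, LinMap.ext fun p => ?_⟩
  · change Tensor.tmul T (P := B.carrier) (LMod.lin (F.map (E.lift z)) p) E.gen = Tensor.tmul T p z
    refine hgen (fun z => ∀ p : B.carrier, Tensor.tmul T (P := B.carrier)
      (LMod.lin (F.map (E.lift z)) p) E.gen = Tensor.tmul T p z) ?_ ?_ ?_ z p
    · intro p
      rw [E.lift_gen_eq_id, F.map_id]; rfl
    · intro t p
      rw [hρ]
      -- Here the right action on `F X` is by definition `F (ρ t)`, so the goal is the balancing
      -- relation itself.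
      exact Tensor.tmul_balanced.balanced p t E.gen
    · intro a b c ha hb hc p
      rw [E.lift_br hV, hF, Tensor.tmul_balanced.br_right, ← ha, ← hb, ← hc]
      exact Tensor.tmul_balanced.br_left _ _ _ _
  · change LMod.lin (F.map (E.lift E.gen)) p = p
    rw [E.lift_gen_eq_id, F.map_id]; rfl


include hV hρ in
/-- A cocontinuous heap functor `F` on a category over `T`-modules with a free generator `X` is
tensoring with `F X`. -/
theorem nonempty_iso_tensor [HasCoproducts.{u} C] (hVff : V.FullyFaithful) (hFc : IsCocontinuous F)
    (hL : IsCocontinuous (V ⋙ (bimodOfAction F hF X ρ hbr hmul).tensorFunctor))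
    (hgen : ∀ q : (V.obj X).carrier → Prop, q E.gen → (∀ t : T, q (t • E.gen)) →
      (∀ a b c, q a → q b → q c → q (br a b c)) → ∀ z, q z) :
    Nonempty (F ≅ V ⋙ (bimodOfAction F hF X ρ hbr hmul).tensorFunctor) := by
  have := E.isIso_of_isIso_app hVff hL hFc _
    (E.isIso_comparison_app hV F hF ρ hbr hmul hρ hgen)
  exact ⟨(asIso (E.comparison hV F hF ρ hbr hmul hρ)).symm⟩

end FreeGenerator
end FreeGenerator

/-! ### The free modules on one generator -/

section

variable {T : Type u} [Truss T]

/-- The linear map `T ⊞ ⋆ ⟶ M` that sends `t` to `t · m` and `*` to `m`. -/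
def unitExtLift {M : LMod T} (m : M.carrier) : unitExtMod T ⟶ M :=
  ({ toHeapHom := UnitExt.desc ⟨fun t : T => t • m, fun a b c => TrussModule.br_smul a b c m⟩ m
     map_smul := fun t z => by
      change UnitExt.desc _ m (UnitExt.ι T t * z) = _
      induction z using UnitExt.induction with
      | h₁ t' => exact TrussModule.mul_smul t t' m
      | h₂ => rfl
      | h₃ a b c ha hb hc =>
        rw [UnitExt.mul_br', HeapHom.map_br, ha, hb, hc, HeapHom.map_br, TrussModule.smul_br] } :
    LinMap T (UnitExt T) M.carrier)

/-- The unital extension of `T` is the free `T`-module on `*`. -/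
def unitExtGenerator (T : Type u) [Truss T] : FreeGenerator (𝟭 (LMod T)) (unitExtMod T) where
  gen := UnitExt.star T
  lift m := unitExtLift m
  lift_gen _ := rfl
  hom_ext {M} f g h := LinMap.ext fun z => by
    induction z using UnitExt.induction with
    | h₁ t =>
      exact ((LMod.lin f).map_smul t (UnitExt.star T)).trans
        ((congrArg (t • ·) h).trans ((LMod.lin g).map_smul t (UnitExt.star T)).symm)
    | h₂ => exact h
    | h₃ a b c ha hb hc =>
      exact ((LMod.lin f).map_br a b c).trans
        ((congr (congrArg₂ br ha hb) hc).trans ((LMod.lin g).map_br a b c).symm)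

theorem unitExtGenerator_lift_smul (t : T) :
    (unitExtGenerator T).lift (t • (unitExtGenerator T).gen) = unitExtRho t :=
  (unitExtGenerator T).hom_ext _ _ rfl

theorem unitExtGenerator_induction (q : UnitExt T → Prop) (h₁ : q (UnitExt.star T))
    (h₂ : ∀ t : T, q (t • UnitExt.star T))
    (h₃ : ∀ a b c, q a → q b → q c → q (br a b c)) (z : UnitExt T) : q z :=
  UnitExt.induction h₂ h₁ h₃ z

variable [UnitalTruss T]

/-- The linear map `T ⟶ M` that sends `t` to `t · m`. -/
def regLift {M : UMod T} (m : M.carrier) : regMod T ⟶ M :=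
  letI := selfModule T
  ({ toFun := fun t => t • m
     map_br := fun a b c => TrussModule.br_smul a b c m
     map_smul := fun s t => TrussModule.mul_smul s t m } : LinMap T T M.carrier)

/-- A unital truss is the free unital module over itself on `1`. -/
def regGenerator (T : Type u) [Truss T] [UnitalTruss T] :
    FreeGenerator (UMod.incl T) (regMod T) where
  gen := (1 : T)
  lift m := regLift m
  lift_gen {M} m := M.one_smul m
  hom_ext {M} f g h := LinMap.ext fun (t : T) => by
    let := selfModule T
    change LinMap T T M.carrier at f g
    change f (1 : T) = g (1 : T) at h
    change f t = g t
    rw [← UnitalTruss.mul_one t]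
    exact (f.map_smul t 1).trans ((congrArg (t • ·) h).trans (g.map_smul t 1).symm)

theorem regGenerator_smul_gen (t : T) : t • (regGenerator T).gen = (show T from t) :=
  UnitalTruss.mul_one t

theorem regGenerator_lift_smul (t : T) :
    (regGenerator T).lift (t • (regGenerator T).gen) = regRho t :=
  (regGenerator T).hom_ext _ _ <| ((regGenerator T).lift_gen _).trans <|
    (regGenerator_smul_gen t).trans (UnitalTruss.one_mul t).symm

end

/-! ### The Eilenberg–Watts theorem -/

section

variable {S T : Type u} [Truss S] [Truss T]

theorem nonempty_iso_bimodOf (F : LMod T ⥤ LMod S) (hFc : IsCocontinuous F)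
    (hF : IsHeapFunctor F) : Nonempty (F ≅ (bimodOf F hF).tensorFunctor) :=
  (unitExtGenerator T).nonempty_iso_tensor (fun _ _ _ _ _ => rfl) F hF unitExtRho _ _
    unitExtGenerator_lift_smul (Functor.FullyFaithful.id _) hFc
    (bimodOf F hF).tensorAdjunction.leftAdjoint_preservesColimits unitExtGenerator_induction

variable [UnitalTruss T]

/-- Right multiplication by `1` is the identity of `T`, and `F` preserves identities. -/
theorem bimodOfUnital_op_one_smul (F : UMod T ⥤ LMod S) (hF : IsHeapFunctor F)
    (p : (bimodOfUnital F hF).carrier) : MulOpposite.op (1 : T) • p = p := by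
  have h : regRho (1 : T) = 𝟙 (regMod T) := LinMap.ext fun t : T => UnitalTruss.mul_one t
  change LMod.lin (F.map (regRho (1 : T))) p = p
  rw [h, F.map_id]; rfl

/-- Right unitality of `F T` is what lets `Hom_S(F T, -)` land in unital modules; it is then right
adjoint to the restricted tensor functor, which is therefore cocontinuous. -/
theorem nonempty_iso_bimodOfUnital (F : UMod T ⥤ LMod S) (hFc : IsCocontinuous F)
    (hF : IsHeapFunctor F) :
    Nonempty (F ≅ UMod.incl T ⋙ (bimodOfUnital F hF).tensorFunctor) :=
  (regGenerator T).nonempty_iso_tensor (fun _ _ _ _ _ => rfl) F hF regRho _ _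
    regGenerator_lift_smul UMod.fullyFaithfulIncl hFc
    ((bimodOfUnital F hF).tensorAdjunctionUnital
      (bimodOfUnital_op_one_smul F hF)).leftAdjoint_preservesColimits
    -- Each `z` in `T` equals `z · 1`, so multiples of the generator already exhaust `T`.
    fun q _ h _ z => (congrArg q (regGenerator_smul_gen (T := T) z)).mp (h z)

end

end TrussTheory

theorem theorem4p3 (T S : Type u) [Truss T] [Truss S] :
    -- functors between categories of all modules
    ((∀ (F : LMod T ⥤ LMod S) (_ : IsCocontinuous F) (hF : IsHeapFunctor F),
        Nonempty (F ≅ (bimodOf F hF).tensorFunctor)) ∧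
      (∀ F : LMod T ⥤ LMod S, F.IsLeftAdjoint ↔ IsCocontinuous F ∧ IsHeapFunctor F)) ∧
    -- functors on unital modules, when `T` has an identity
    (∀ [UnitalTruss T],
      (∀ (F : UMod T ⥤ LMod S) (_ : IsCocontinuous F) (hF : IsHeapFunctor F),
        (∀ p : (bimodOfUnital F hF).carrier, MulOpposite.op (1 : T) • p = p) ∧
        Nonempty (F ≅ UMod.incl T ⋙ (bimodOfUnital F hF).tensorFunctor)) ∧
      (∀ F : UMod T ⥤ LMod S, F.IsLeftAdjoint ↔ IsCocontinuous F ∧ IsHeapFunctor F)) := by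
  refine ⟨⟨nonempty_iso_bimodOf, fun F => ⟨fun _ => ?_, fun ⟨hFc, hF⟩ => ?_⟩⟩,
    fun {_} => ⟨fun F hFc hF => ⟨bimodOfUnital_op_one_smul F hF,
      nonempty_iso_bimodOfUnital F hFc hF⟩, fun F => ⟨fun _ => ?_, fun ⟨hFc, hF⟩ => ?_⟩⟩⟩
  · have hFc : IsCocontinuous F := (Adjunction.ofIsLeftAdjoint F).leftAdjoint_preservesColimits
    exact ⟨hFc, isHeapFunctor_of_isCocontinuous F hFc⟩
  -- The right adjoint is `Hom_S(P, -)` with `P` the bimodule attached to `F`.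
  · obtain ⟨e⟩ := nonempty_iso_bimodOf F hFc hF
    exact ⟨_, ⟨(bimodOf F hF).tensorAdjunction.ofNatIsoLeft e.symm⟩⟩
  · have hFc : IsCocontinuous F := (Adjunction.ofIsLeftAdjoint F).leftAdjoint_preservesColimits
    exact ⟨hFc, isHeapFunctor_of_isCocontinuous F hFc⟩
  · obtain ⟨e⟩ := nonempty_iso_bimodOfUnital F hFc hF
    exact ⟨_, ⟨((bimodOfUnital F hF).tensorAdjunctionUnital
      (bimodOfUnital_op_one_smul F hF)).ofNatIsoLeft e.symm⟩⟩
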